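/- Let $N,n\ge 1$ be integers and let $\lambda_1,\dots,\lambda_n\in\overline{\mathbb Q}^{\times}$ be pairwise distinct. Put $k_X=\mathbb Q(\lambda_1,\dots,\lambda_n)$, and let $k_E=\mathbb Q(\lambda_1,\dots,\lambda_n)^{S_n}$ be the subfield of elements fixed by all automorphisms of $k_X$ that permute $\lambda_1,\dots,\lambda_n$. Let $X_{N,n}$ be the smooth projective curve over $k_X$ with affine model $$x^N+(-1)^n y_i^N=\lambda_i\qquad(1\le i\le n),$$ and let $E_{N,n}$ be the smooth projective curve over $k_E$ with affine model $$Y^N=X(X-\lambda_1)\cdots(X-\lambda_n).$$ For a smooth projective curve $C$ over a field $k$ with function field $k(C)$, let $\tau=(\tau_P)_P\colon K_2^M(k(C))\to\bigoplus_{P}\kappa(P)^\times$ ($P$ running over the closed points of $C$) be the tame symbol, $$\tau_P(\{f,g\})=(-1)^{\operatorname{ord}_P f\,\operatorname{ord}_P g}\left(\frac{f^{\operatorname{ord}_P g}}{g^{\operatorname{ord}_P f}}\right)(P),$$ and let $$H^2_{\mathscr M}(C,\mathbb Q(2))=\operatorname{Ker}\Big(\tau\otimes\mathbb Q\colon K_2^M(k(C))\otimes\mathbb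 Q\to\bigoplus_{P}\kappa(P)^\times\otimes\mathbb Q\Big).$$ **Theorem 3.1.** Suppose that $\Phi(T)=T\prod_{i=1}^n(T-\lambda_i)-1$ factors in $\overline{\mathbb Q}[T]$ as $$\Phi(T)=(T-\nu_1)\cdots(T-\nu_n)\bigl(T-(-1)^n(\nu_1\cdots\nu_n)^{-1}\bigr)$$ with roots of unity $\nu_1,\dots,\nu_n\in\overline{\mathbb Q}$. Let $\xi_{X_{N,n}}=\{1-xy_1\cdots y_n,\,x\}\in K_2^M(k_X(X_{N,n}))$. Then: 1. there is a positive integer $M$ such that $\xi_{X_{N,n}}^M\in\operatorname{Ker}\tau$ on $X_{N,n}$; 2. hence $\xi_{X_{N,n}}$ defines a class in $H^2_{\mathscr M}(X_{N,n},\mathbb Q(2))$; 3. there is an embedding of function fields $k_E(E_{N,n})\to k_X(X_{N,n})$, extending $k_E\subset k_X$, with $X\mapsto x^N$ and $Y\mapsto xy_1\cdots y_n$ (the pullback along the covering $X_{N,n}\to E_{N,n}$), and the induced map on $K_2^M$ sends $\{1-Y,X\}$ to $\xi_{X_{N,n}}^N$; 4. $\{1-Y,X\}$ defines a class in $H^2_{\mathscr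 M}(E_{N,n},\mathbb Q(2))$. -/

import Mathlib

open Polynomial
open scoped TensorProduct WithZero

noncomputable section

namespace GenFermat

/-! ### Milnor `K₂` of a field -/

/-- The Steinberg relations: the subgroup of `Fˣ ⊗ Fˣ` generated by all `a ⊗ b` with `a + b = 1`. -/
def steinberg (F : Type*) [Field F] : Submodule ℤ (Additive Fˣ ⊗[ℤ] Additive Fˣ) :=
  Submodule.span ℤ {t | ∃ a b : Fˣ, (a : F) + (b : F) = 1 ∧
    t = Additive.ofMul a ⊗ₜ[ℤ] Additive.ofMul b}

/-- The Milnor group `K₂ᴹ(F) = (Fˣ ⊗ Fˣ) / ⟨a ⊗ (1 - a)⟩`, written additively. -/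
abbrev MilnorK2 (F : Type*) [Field F] : Type _ :=
  (Additive Fˣ ⊗[ℤ] Additive Fˣ) ⧸ steinberg F

/-- The Milnor symbol `{f, g}`. -/
def symbol {F : Type*} [Field F] (f g : Fˣ) : MilnorK2 F :=
  (steinberg F).mkQ (Additive.ofMul f ⊗ₜ[ℤ] Additive.ofMul g)

/-- The homomorphism on units, written additively, induced by a homomorphism of fields. -/
def unitsMap {F L : Type*} [Field F] [Field L] (p : F →+* L) : Additive Fˣ →ₗ[ℤ] Additive Lˣ :=
  (MonoidHom.toAdditive (Units.map (p : F →* L))).toIntLinearMap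

theorem steinberg_le_comap {F L : Type*} [Field F] [Field L] (p : F →+* L) :
    steinberg F ≤ (steinberg L).comap (TensorProduct.map (unitsMap p) (unitsMap p)) := by
  refine Submodule.span_le.2 ?_
  rintro _ ⟨a, b, hab, rfl⟩
  refine Submodule.subset_span ⟨Units.map (p : F →* L) a, Units.map (p : F →* L) b, ?_, rfl⟩
  simp only [Units.coe_map, MonoidHom.coe_coe]
  rw [← map_add, hab, map_one]

/-- The homomorphism `K₂ᴹ(F) → K₂ᴹ(L)`, `{f, g} ↦ {p f, p g}`, induced by `p : F → L`. -/
def MilnorK2.map {F L : Type*} [Field F] [Field L] (p : F →+* L) : MilnorK2 F →ₗ[ℤ] MilnorK2 L :=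
  Submodule.mapQ (steinberg F) (steinberg L) (TensorProduct.map (unitsMap p) (unitsMap p))
    (steinberg_le_comap p)

/-! ### Closed points and the tame symbol

A smooth projective curve `C` over `k` is determined by its function field `F = k(C)`, and its closed
points correspond to the normalized discrete valuations of `F` that are trivial on `k`: to a point
belongs the order of vanishing there, and the residue field of the point is that of the valuation. -/

/-- A closed point of the smooth projective curve over `k` with function field `F`. -/
structure ClosedPoint (k F : Type*) [Field k] [Field F] [Algebra k F] where
  /-- the associated valuation; multiplicatively written, `val f = exp (- ord f)` -/
  val : Valuation F ℤᵐ⁰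
  surjective : Function.Surjective val
  trivial_on : ∀ c : k, c ≠ 0 → val (algebraMap k F c) = 1

namespace ClosedPoint

variable {k F : Type*} [Field k] [Field F] [Algebra k F] (v : ClosedPoint k F)

/-- The order of vanishing at a closed point. -/
def ord (f : Fˣ) : ℤ := -WithZero.log (v.val f)

/-- The residue field `κ(v)` of a closed point. -/
abbrev residueField : Type _ := IsLocalRing.ResidueField v.val.valuationSubring

theorem val_ne_zero (f : Fˣ) : v.val f ≠ 0 := (Valuation.ne_zero_iff _).2 f.ne_zero

theorem val_eq (f : Fˣ) : v.val f = WithZero.exp (-v.ord f) := by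
  rw [ord, neg_neg, WithZero.exp_log (v.val_ne_zero f)]

theorem ord_mul (f g : Fˣ) : v.ord (f * g) = v.ord f + v.ord g := by
  simp only [ord, Units.val_mul, map_mul]
  rw [WithZero.log_mul (v.val_ne_zero f) (v.val_ne_zero g)]
  ring

theorem mem_unitGroup_iff (f : Fˣ) : f ∈ v.val.valuationSubring.unitGroup ↔ v.ord f = 0 := by
  rw [ValuationSubring.mem_unitGroup_iff,
    ← (Valuation.isEquiv_valuation_valuationSubring v.val).eq_one_iff_eq_one, v.val_eq,
    ← WithZero.exp_zero, WithZero.exp_inj, neg_eq_zero]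

/-- The function `(-1) ^ (ord f * ord g) * f ^ (ord g) / g ^ (ord f)`. -/
def tameFun (f g : Fˣ) : Fˣ := (-1) ^ (v.ord f * v.ord g) * (f ^ v.ord g / g ^ v.ord f)

theorem ord_one : v.ord 1 = 0 := by simp [ord]

theorem ord_inv (f : Fˣ) : v.ord f⁻¹ = -v.ord f := by
  have h := v.ord_mul f f⁻¹
  rw [mul_inv_cancel, ord_one] at h
  linarith

theorem ord_neg_one : v.ord (-1) = 0 := by
  have h := v.ord_mul (-1) (-1)
  rw [neg_one_mul, neg_neg, ord_one] at h
  linarith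

theorem ord_zpow (f : Fˣ) (m : ℤ) : v.ord (f ^ m) = m * v.ord f := by
  simp only [ord, Units.val_zpow_eq_zpow_val, map_zpow₀, WithZero.log_zpow, smul_eq_mul]
  ring

theorem ord_tameFun (f g : Fˣ) : v.ord (v.tameFun f g) = 0 := by
  rw [tameFun, ord_mul, div_eq_mul_inv, ord_mul, ord_inv, ord_zpow, ord_zpow, ord_zpow,
    ord_neg_one]
  ring

theorem tameFun_mul_left (f₁ f₂ g : Fˣ) :
    v.tameFun (f₁ * f₂) g = v.tameFun f₁ g * v.tameFun f₂ g := by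
  simp only [tameFun, ord_mul, add_mul, zpow_add, mul_zpow, div_eq_mul_inv, mul_inv]
  ac_rfl

theorem tameFun_mul_right (f g₁ g₂ : Fˣ) :
    v.tameFun f (g₁ * g₂) = v.tameFun f g₁ * v.tameFun f g₂ := by
  simp only [tameFun, ord_mul, mul_add, zpow_add, mul_zpow, div_eq_mul_inv, mul_inv]
  ac_rfl

/-- The value at `v` of a function of order zero. -/
def residue : v.val.valuationSubring.unitGroup →* (v.residueField)ˣ :=
  v.val.valuationSubring.unitGroupToResidueFieldUnits

/-- The tame symbol of a pair of functions:
`τ_v(f, g) = ((-1) ^ (ord f * ord g) * f ^ (ord g) / g ^ (ord f))(v)`. -/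
def tamePair (f g : Fˣ) : (v.residueField)ˣ :=
  v.residue ⟨v.tameFun f g, (v.mem_unitGroup_iff _).2 (v.ord_tameFun f g)⟩

theorem tamePair_mul_left (f₁ f₂ g : Fˣ) :
    v.tamePair (f₁ * f₂) g = v.tamePair f₁ g * v.tamePair f₂ g := by
  rw [tamePair, tamePair, tamePair, ← map_mul]
  congr 1
  exact Subtype.ext (v.tameFun_mul_left f₁ f₂ g)

theorem tamePair_mul_right (f g₁ g₂ : Fˣ) :
    v.tamePair f (g₁ * g₂) = v.tamePair f g₁ * v.tamePair f g₂ := by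
  rw [tamePair, tamePair, tamePair, ← map_mul]
  congr 1
  exact Subtype.ext (v.tameFun_mul_right f g₁ g₂)

theorem residue_eq_one (u : v.val.valuationSubring.unitGroup)
    (hu : v.val (((u : Fˣ) : F) - 1) < 1) : v.residue u = 1 := by
  have hmem : u ∈ (v.val.valuationSubring.unitGroupToResidueFieldUnits).ker := by
    rw [ValuationSubring.ker_unitGroupToResidueFieldUnits, Subgroup.mem_comap]
    rw [Subgroup.subtype_apply, ValuationSubring.mem_principalUnitGroup_iff,
      ← (Valuation.isEquiv_valuation_valuationSubring v.val).lt_one_iff_lt_one]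
    exact hu
  exact hmem

theorem val_lt_one_of_ord_pos {f : Fˣ} (hf : 0 < v.ord f) : v.val f < 1 := by
  rw [v.val_eq, ← WithZero.exp_zero, WithZero.exp_lt_exp]
  linarith

theorem ord_eq_of_val_eq {f g : Fˣ} (h : v.val f = v.val g) : v.ord f = v.ord g := by
  rw [ord, ord, h]

/-- The tame symbol satisfies the Steinberg relation. -/
theorem tamePair_of_add_eq_one {f g : Fˣ} (h : (f : F) + (g : F) = 1) : v.tamePair f g = 1 := by
  have hf : (f : F) = 1 - g := eq_sub_of_add_eq h
  have hg : (g : F) = 1 - f := eq_sub_of_add_eq' h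
  have key : ∀ (u w : Fˣ) (m : ℤ), (u : F) = 1 - w → 0 < v.ord w →
      ∀ hu : u ^ m ∈ v.val.valuationSubring.unitGroup, v.residue ⟨u ^ m, hu⟩ = 1 := by
    intro u w m hu hw hum
    have hlt := v.val_lt_one_of_ord_pos hw
    have hv : v.val u = 1 := by
      rw [hu, Valuation.map_sub_eq_of_lt_left _ (by rwa [map_one]), map_one]
    have hmem : u ∈ v.val.valuationSubring.unitGroup := by
      rw [v.mem_unitGroup_iff, ord, hv, WithZero.log_one, neg_zero]
    have h1 : v.residue ⟨u, hmem⟩ = 1 := by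
      apply residue_eq_one
      show v.val ((u : F) - 1) < 1
      rw [hu, sub_sub_cancel_left, Valuation.map_neg]
      exact hlt
    have h2 : (⟨u ^ m, hum⟩ : v.val.valuationSubring.unitGroup) = ⟨u, hmem⟩ ^ m := rfl
    rw [h2, map_zpow, h1, one_zpow]
  have hzero : ∀ u w : Fˣ, (u : F) = 1 - w → 0 < v.ord w → v.ord u = 0 := by
    intro u w hu hw
    rw [ord, hu, Valuation.map_sub_eq_of_lt_left _ (by rw [map_one]; exact v.val_lt_one_of_ord_pos hw),
      map_one, WithZero.log_one, neg_zero]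
  rcases lt_trichotomy (v.ord g) 0 with hneg | h0 | hpos
  · -- both functions have the same pole order, and `f / g` has value `-1`
    have hlt : v.val 1 < v.val (g : F) := by
      rw [map_one, v.val_eq, ← WithZero.exp_zero, WithZero.exp_lt_exp]; linarith
    have heq : v.ord f = v.ord g := by
      apply v.ord_eq_of_val_eq
      rw [hf, Valuation.map_sub_eq_of_lt_right _ hlt]
    have hfun : v.tameFun f g = (-(f / g)) ^ v.ord g := by
      have hpar : ((-1 : Fˣ)) ^ (v.ord g * v.ord g) = (-1) ^ v.ord g := by
        rcases Int.even_or_odd (v.ord g) with he | ho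
        · rw [he.neg_one_zpow, (he.mul_left _).neg_one_zpow]
        · rw [ho.neg_one_zpow, (ho.mul ho).neg_one_zpow]
      rw [tameFun, heq, hpar, ← div_zpow, ← mul_zpow, neg_one_mul]
    have hmem := (v.mem_unitGroup_iff _).2 (v.ord_tameFun f g)
    rw [tamePair]
    have hcong : (⟨v.tameFun f g, hmem⟩ : v.val.valuationSubring.unitGroup)
        = ⟨(-(f / g)) ^ v.ord g, hfun ▸ hmem⟩ := Subtype.ext hfun
    rw [hcong]
    refine key (-(f / g)) g⁻¹ _ ?_ ?_ _
    · rw [Units.val_neg, Units.val_div_eq_div_val, Units.val_inv_eq_inv_val, hf]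
      field_simp
      ring
    · rw [ord_inv]; linarith
  · rcases lt_trichotomy (v.ord f) 0 with hneg | h0f | hpos
    · exfalso
      have hlt : v.val 1 < v.val (f : F) := by
        rw [map_one, v.val_eq, ← WithZero.exp_zero, WithZero.exp_lt_exp]; linarith
      have : v.ord g = v.ord f := by
        apply v.ord_eq_of_val_eq
        rw [hg, Valuation.map_sub_eq_of_lt_right _ hlt]
      omega
    · have hfun : v.tameFun f g = 1 := by simp [tameFun, h0, h0f]
      have hmem := (v.mem_unitGroup_iff _).2 (v.ord_tameFun f g)
      have hcong : (⟨v.tameFun f g, hmem⟩ : v.val.valuationSubring.unitGroup) = 1 :=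
        Subtype.ext hfun
      rw [tamePair, hcong, map_one]
    · have hfun : v.tameFun f g = g ^ (-v.ord f) := by simp [tameFun, h0]
      have hmem := (v.mem_unitGroup_iff _).2 (v.ord_tameFun f g)
      have hcong : (⟨v.tameFun f g, hmem⟩ : v.val.valuationSubring.unitGroup)
          = ⟨g ^ (-v.ord f), hfun ▸ hmem⟩ := Subtype.ext hfun
      rw [tamePair, hcong]
      exact key g f _ hg hpos _
  · have h0f := hzero f g hf hpos
    have hfun : v.tameFun f g = f ^ v.ord g := by simp [tameFun, h0f]
    have hmem := (v.mem_unitGroup_iff _).2 (v.ord_tameFun f g)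
    have hcong : (⟨v.tameFun f g, hmem⟩ : v.val.valuationSubring.unitGroup)
        = ⟨f ^ v.ord g, hfun ▸ hmem⟩ := Subtype.ext hfun
    rw [tamePair, hcong]
    exact key f g _ hf hpos _

/-- The tame symbol as a bilinear map. -/
def tameBilin : Additive Fˣ →+ Additive Fˣ →+ Additive (v.residueField)ˣ :=
  AddMonoidHom.mk'
    (fun f => AddMonoidHom.mk' (fun g => Additive.ofMul (v.tamePair f.toMul g.toMul))
      (fun g₁ g₂ => congrArg Additive.ofMul (v.tamePair_mul_right f.toMul g₁.toMul g₂.toMul)))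
    (fun f₁ f₂ => AddMonoidHom.ext fun g =>
      congrArg Additive.ofMul (v.tamePair_mul_left f₁.toMul f₂.toMul g.toMul))

/-- The tame symbol on `Fˣ ⊗ Fˣ`. -/
def tameTensor : Additive Fˣ ⊗[ℤ] Additive Fˣ →ₗ[ℤ] Additive (v.residueField)ˣ :=
  (TensorProduct.liftAddHom v.tameBilin (fun m f g => by
    rw [map_zsmul, map_zsmul, AddMonoidHom.zsmul_apply])).toIntLinearMap

/-- The tame symbol `τ_v : K₂ᴹ(F) → κ(v)ˣ`, characterized by `τ_v {f, g} = tamePair f g`. -/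
def tame : MilnorK2 F →ₗ[ℤ] Additive (v.residueField)ˣ :=
  (steinberg F).liftQ v.tameTensor (by
    refine Submodule.span_le.2 ?_
    rintro _ ⟨a, b, hab, rfl⟩
    exact congrArg Additive.ofMul (v.tamePair_of_add_eq_one hab))

theorem tame_symbol (f g : Fˣ) : v.tame (symbol f g) = Additive.ofMul (v.tamePair f g) := rfl

end ClosedPoint

/-- The kernel of the tame symbol `τ = (τ_v)_v` on `K₂ᴹ(k(C))`. -/
def tameKernel (k F : Type*) [Field k] [Field F] [Algebra k F] : Submodule ℤ (MilnorK2 F) :=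
  ⨅ v : ClosedPoint k F, LinearMap.ker v.tame

/-- `H²_M(C, ℚ(2))`, as the kernel of `τ ⊗ ℚ : K₂ᴹ(k(C)) ⊗ ℚ → ⨁_v κ(v)ˣ ⊗ ℚ`. An element of the
direct sum vanishes if and only if all its components do, so this is the intersection of the kernels
of the components `τ_v ⊗ ℚ`. -/
def motivicH2 (k F : Type*) [Field k] [Field F] [Algebra k F] :
    Submodule ℚ (ℚ ⊗[ℤ] MilnorK2 F) :=
  ⨅ v : ClosedPoint k F, LinearMap.ker (v.tame.baseChange ℚ)

/-! ### The coordinate rings are domains -/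


theorem exists_pow_eq_of_constantCoeff_ne_zero {K : Type*} [Field K] [IsAlgClosed K] [CharZero K]
    {N : ℕ} (hN : 0 < N) (u : PowerSeries K) (hu : PowerSeries.constantCoeff u ≠ 0) :
    ∃ w : PowerSeries K, w ^ N = u := by
  obtain ⟨b, hb⟩ := IsAlgClosed.exists_pow_nat_eq (PowerSeries.constantCoeff u) hN
  have hb0 : b ≠ 0 := by
    rintro rfl
    rw [zero_pow hN.ne'] at hb
    exact hu hb.symm
  have hmonic : (X ^ N - C u : (PowerSeries K)[X]).Monic := monic_X_pow_sub_C u hN.ne'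
  obtain ⟨w, hw, -⟩ := HenselianRing.is_henselian (I := Ideal.span {(PowerSeries.X : PowerSeries K)})
    (X ^ N - C u) hmonic (PowerSeries.C b)
    (by
      rw [Ideal.mem_span_singleton, PowerSeries.X_dvd_iff]
      simp [hb])
    (by
      apply IsUnit.map
      rw [PowerSeries.isUnit_iff_constantCoeff]
      simp [Polynomial.derivative_X_pow, hb0, hN.ne'])
  refine ⟨w, ?_⟩
  simpa [sub_eq_zero] using hw

theorem irreducible_X_pow_sub_C_powerSeries {K : Type*} [Field K] {N : ℕ} (hN : 0 < N)
    (u : PowerSeries K) (h0 : PowerSeries.constantCoeff u = 0) (h1 : PowerSeries.coeff 1 u ≠ 0) :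
    Irreducible (X ^ N - C u : (PowerSeries K)[X]) := by
  have hmonic : (X ^ N - C u : (PowerSeries K)[X]).Monic := monic_X_pow_sub_C u hN.ne'
  have hdeg : (X ^ N - C u : (PowerSeries K)[X]).degree = N := degree_X_pow_sub_C hN u
  have hu : PowerSeries.X ∣ u := PowerSeries.X_dvd_iff.2 h0
  have hP : (Ideal.span {(PowerSeries.X : PowerSeries K)}).IsPrime :=
    (Ideal.span_singleton_prime PowerSeries.X_ne_zero).2 PowerSeries.X_prime
  refine irreducible_of_eisenstein_criterion hP ?_ ?_ ?_ ?_ hmonic.isPrimitive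
  · rw [hmonic.leadingCoeff, ← Ideal.ne_top_iff_one]
    exact hP.ne_top
  · intro m hm
    rw [hdeg, Nat.cast_lt] at hm
    rw [coeff_sub, coeff_X_pow, if_neg hm.ne, zero_sub, neg_mem_iff, coeff_C]
    split_ifs
    · exact Ideal.mem_span_singleton.2 hu
    · exact zero_mem _
  · rw [hdeg]; exact_mod_cast hN
  · rw [coeff_sub, coeff_X_pow, if_neg hN.ne, zero_sub, neg_mem_iff, coeff_C_zero,
      Ideal.span_singleton_pow, Ideal.mem_span_singleton, PowerSeries.X_pow_dvd_iff]
    intro h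
    exact h1 (h 1 one_lt_two)

theorem exists_pow_eq_laurent {K : Type*} [Field K] [IsAlgClosed K] [CharZero K]
    {N : ℕ} (hN : 0 < N) (u : PowerSeries K) (hu : PowerSeries.constantCoeff u ≠ 0) :
    (X ^ N - C (algebraMap (PowerSeries K) (LaurentSeries K) u)).Splits := by
  obtain ⟨w, hw⟩ := exists_pow_eq_of_constantCoeff_ne_zero hN u hu
  have : NeZero N := ⟨hN.ne'⟩
  obtain ⟨ζ, hζ⟩ := HasEnoughRootsOfUnity.exists_primitiveRoot K N
  have h2 : IsPrimitiveRoot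
      (((algebraMap (PowerSeries K) (LaurentSeries K)).comp (PowerSeries.C (R := K))) ζ) N :=
    hζ.map_of_injective (RingHom.injective _)
  exact X_pow_sub_C_splits_of_isPrimitiveRoot h2 (α := algebraMap _ _ w) (by rw [← map_pow, hw])

theorem irreducible_step
    {ι R K : Type*} [CommRing R] [IsDomain R] [Field K] [IsAlgClosed K] [CharZero K]
    {N : ℕ} (hN : 0 < N) (a : ι → R) (φ : ι → R →+* PowerSeries K)
    (hφ : ∀ i, Function.Injective (φ i))
    (hne : ∀ i j, j ≠ i → PowerSeries.constantCoeff (φ i (a j)) ≠ 0)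
    (h0 : ∀ i, PowerSeries.constantCoeff (φ i (a i)) = 0)
    (h1 : ∀ i, PowerSeries.coeff 1 (φ i (a i)) ≠ 0)
    {Ω : Type*} [Field Ω] [Algebra (FractionRing R) Ω] (y : ι → Ω)
    (hy : ∀ i, y i ^ N = algebraMap (FractionRing R) Ω (algebraMap R _ (a i)))
    (s : Finset ι) (i : ι) (hi : i ∉ s) :
    Irreducible (X ^ N - C (algebraMap (FractionRing R)
      (IntermediateField.adjoin (FractionRing R) (y '' (s : Set ι))) (algebraMap R _ (a i)))) := by
  have hinj : Function.Injective
      ((algebraMap (PowerSeries K) (LaurentSeries K)).comp (φ i)) :=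
    (IsFractionRing.injective (PowerSeries K) (LaurentSeries K)).comp (hφ i)
  let ψ : FractionRing R →+* LaurentSeries K := IsFractionRing.lift hinj
  have hψ : ∀ r, ψ (algebraMap R _ r) = algebraMap (PowerSeries K) (LaurentSeries K) (φ i r) :=
    fun r => IsFractionRing.lift_algebraMap hinj r
  let _ : Algebra (FractionRing R) (LaurentSeries K) := ψ.toAlgebra
  have hmap : ∀ r, algebraMap (FractionRing R) (LaurentSeries K) r = ψ r := fun _ => rfl
  obtain ⟨g⟩ := IntermediateField.nonempty_algHom_adjoin_of_splits (F := FractionRing R) (E := Ω)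
    (K := LaurentSeries K) (S := y '' (s : Set ι)) (by
      rintro _ ⟨j, hj, rfl⟩
      have hroot : aeval (y j) (X ^ N - C (algebraMap R (FractionRing R) (a j))) = 0 := by
        simp [hy j]
      have hm : (X ^ N - C (algebraMap R (FractionRing R) (a j))).Monic :=
        monic_X_pow_sub_C _ hN.ne'
      refine ⟨⟨_, hm, hroot⟩, ?_⟩
      have hji : j ≠ i := fun h => hi (h ▸ hj)
      have hs := exists_pow_eq_laurent hN (φ i (a j)) (hne i j hji)
      have hs' : (map (algebraMap (FractionRing R) (LaurentSeries K))
          (X ^ N - C (algebraMap R (FractionRing R) (a j)))).Splits := by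
        simpa [hmap, hψ] using hs
      exact hs'.of_dvd (map_monic_ne_zero hm)
        (Polynomial.map_dvd _ (minpoly.dvd _ _ hroot)))
  refine Monic.irreducible_of_irreducible_map g.toRingHom _ (monic_X_pow_sub_C _ hN.ne') ?_
  have h3 := (Monic.irreducible_iff_irreducible_map_fraction_map (K := LaurentSeries K)
    (monic_X_pow_sub_C (φ i (a i)) hN.ne')).1
    (irreducible_X_pow_sub_C_powerSeries hN (φ i (a i)) (h0 i) (h1 i))
  have h4 : g (algebraMap (FractionRing R) _ (algebraMap R _ (a i)))
      = algebraMap (PowerSeries K) (LaurentSeries K) (φ i (a i)) := by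
    rw [AlgHom.commutes, hmap, hψ]
  simpa [h4] using h3

theorem finrank_step
    {ι R K : Type*} [DecidableEq ι] [CommRing R] [IsDomain R] [Field K] [IsAlgClosed K] [CharZero K]
    {N : ℕ} (hN : 0 < N) (a : ι → R) (φ : ι → R →+* PowerSeries K)
    (hφ : ∀ i, Function.Injective (φ i))
    (hne : ∀ i j, j ≠ i → PowerSeries.constantCoeff (φ i (a j)) ≠ 0)
    (h0 : ∀ i, PowerSeries.constantCoeff (φ i (a i)) = 0)
    (h1 : ∀ i, PowerSeries.coeff 1 (φ i (a i)) ≠ 0)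
    {Ω : Type*} [Field Ω] [Algebra (FractionRing R) Ω] (y : ι → Ω)
    (hy : ∀ i, y i ^ N = algebraMap (FractionRing R) Ω (algebraMap R _ (a i)))
    (s : Finset ι) :
    Module.finrank (FractionRing R) (IntermediateField.adjoin (FractionRing R) (y '' (s : Set ι)))
      = N ^ s.card := by
  induction s using Finset.induction_on with
  | empty => simp
  | insert i s hi ih =>
    set L := IntermediateField.adjoin (FractionRing R) (y '' (s : Set ι)) with hL
    have hirr := irreducible_step hN a φ hφ hne h0 h1 y hy s i hi
    rw [← hL] at hirr
    have hroot : aeval (y i) (X ^ N - C (algebraMap (FractionRing R) L (algebraMap R _ (a i)))) = 0 := by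
      rw [map_sub, map_pow, aeval_X, aeval_C, ← IsScalarTower.algebraMap_apply, hy i, sub_self]
    have hmp := minpoly.eq_of_irreducible_of_monic hirr hroot (monic_X_pow_sub_C _ hN.ne')
    have hint : IsIntegral L (y i) := ⟨_, monic_X_pow_sub_C _ hN.ne', hroot⟩
    have hfr : Module.finrank L (IntermediateField.adjoin L {y i}) = N := by
      rw [IntermediateField.adjoin.finrank hint, ← hmp, natDegree_X_pow_sub_C]
    have hadj := IntermediateField.adjoin_adjoin_left (FractionRing R) (y '' (s : Set ι)) {y i}
    have hset : y '' ((insert i s : Finset ι) : Set ι) = y '' (s : Set ι) ∪ {y i} := by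
      rw [Finset.coe_insert, Set.image_insert_eq, Set.union_singleton]
    rw [hset, ← hadj, Finset.card_insert_of_notMem hi, pow_succ, ← ih, ← hfr]
    exact (Module.finrank_mul_finrank (FractionRing R) L (IntermediateField.adjoin L {y i})).symm


/-- Monomials with all exponents below `N` span an algebra generated by elements whose `N`-th
powers are scalars. -/
theorem span_monomials {ι S B : Type*} [Fintype ι] [DecidableEq ι] [CommRing S] [CommRing B] [Algebra S B]
    {N : ℕ} (hN : 0 < N) (a : ι → S) (y : ι → B) (hy : ∀ i, y i ^ N = algebraMap S B (a i))
    (p : MvPolynomial ι S) :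
    MvPolynomial.aeval y p ∈
      Submodule.span S (Set.range fun e : ι → Fin N => ∏ i, y i ^ (e i : ℕ)) := by
  set V := Submodule.span S (Set.range fun e : ι → Fin N => ∏ i, y i ^ (e i : ℕ)) with hV
  have hmem : ∀ e : ι → ℕ, (∀ i, e i < N) → ∏ i, y i ^ e i ∈ V := fun e he =>
    Submodule.subset_span ⟨fun i => ⟨e i, he i⟩, rfl⟩
  have hmul : ∀ j, ∀ v ∈ V, v * y j ∈ V := by
    intro j v hv
    induction hv using Submodule.span_induction with
    | mem v hv =>
      obtain ⟨e, rfl⟩ := hv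
      have hsplit : (∏ i, y i ^ (e i : ℕ)) * y j
          = (∏ i ∈ Finset.univ.erase j, y i ^ (e i : ℕ)) * y j ^ ((e j : ℕ) + 1) := by
        rw [← Finset.prod_erase_mul _ _ (Finset.mem_univ j), pow_succ, mul_assoc]
      have hupd : ∀ m : ℕ, ∏ i, y i ^ (Function.update (fun i => (e i : ℕ)) j m i)
          = (∏ i ∈ Finset.univ.erase j, y i ^ (e i : ℕ)) * y j ^ m := by
        intro m
        rw [← Finset.prod_erase_mul _ _ (Finset.mem_univ j)]
        congr 1
        · refine Finset.prod_congr rfl fun i hi => ?_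
          rw [Function.update_of_ne (Finset.ne_of_mem_erase hi)]
        · rw [Function.update_self]
      have hlt : ∀ m < N, ∀ i, Function.update (fun i => (e i : ℕ)) j m i < N := by
        intro m hm i
        by_cases h : i = j
        · subst h; simpa using hm
        · simp [Function.update_of_ne h]
      show (∏ i, y i ^ (e i : ℕ)) * y j ∈ V
      rw [hsplit]
      rcases Nat.lt_or_ge ((e j : ℕ) + 1) N with h | h
      · rw [← hupd]
        exact hmem _ (hlt _ h)
      · have hN' : (e j : ℕ) + 1 = N := le_antisymm (e j).2 h
        rw [hN', hy, mul_comm, ← Algebra.smul_def]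
        refine V.smul_mem _ ?_
        have := hmem _ (hlt 0 hN)
        rwa [hupd, pow_zero, mul_one] at this
    | zero => simp
    | add u v _ _ hu hv => rw [add_mul]; exact V.add_mem hu hv
    | smul c v _ hv => rw [smul_mul_assoc]; exact V.smul_mem c hv
  induction p using MvPolynomial.induction_on with
  | C c =>
    rw [MvPolynomial.aeval_C, Algebra.algebraMap_eq_smul_one]
    refine V.smul_mem _ ?_
    simpa using hmem (fun _ => 0) (fun _ => hN)
  | add p q hp hq => rw [map_add]; exact V.add_mem hp hq
  | mul_X p j hp => rw [map_mul, MvPolynomial.aeval_X]; exact hmul j _ hp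

theorem isPrime_kummerIdeal {ι R K : Type*} [Fintype ι] [CommRing R] [IsDomain R] [Field K]
    [IsAlgClosed K] [CharZero K] {N : ℕ} (hN : 0 < N) (a : ι → R) (φ : ι → R →+* PowerSeries K)
    (hφ : ∀ i, Function.Injective (φ i))
    (hne : ∀ i j, j ≠ i → PowerSeries.constantCoeff (φ i (a j)) ≠ 0)
    (h0 : ∀ i, PowerSeries.constantCoeff (φ i (a i)) = 0)
    (h1 : ∀ i, PowerSeries.coeff 1 (φ i (a i)) ≠ 0)
    (I : Ideal (MvPolynomial ι R))
    (hI : I = Ideal.span (Set.range fun i => MvPolynomial.X i ^ N - MvPolynomial.C (a i))) :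
    I.IsPrime := by
  classical
  let E := FractionRing R
  let Ω := AlgebraicClosure E
  have hroots : ∀ i, ∃ z : Ω, z ^ N = algebraMap E Ω (algebraMap R E (a i)) := fun i =>
    IsAlgClosed.exists_pow_nat_eq _ hN
  choose y hy using hroots
  have hyR : ∀ i, y i ^ N = algebraMap R Ω (a i) := fun i => by
    rw [hy i, ← IsScalarTower.algebraMap_apply]
  have hker : I = RingHom.ker (MvPolynomial.aeval (R := R) y).toRingHom := by
    apply le_antisymm
    · rw [hI, Ideal.span_le]
      rintro _ ⟨i, rfl⟩
      simp [RingHom.mem_ker, hyR]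
    · intro p hp
      have hp0 : MvPolynomial.aeval y p = 0 := hp
      let q : ι → MvPolynomial ι R ⧸ I := fun i => Ideal.Quotient.mk I (MvPolynomial.X i)
      have hq : ∀ i, q i ^ N = algebraMap R _ (a i) := by
        intro i
        have : Ideal.Quotient.mk I (MvPolynomial.X i ^ N - MvPolynomial.C (a i)) = 0 := by
          rw [Ideal.Quotient.eq_zero_iff_mem, hI]
          exact Ideal.subset_span ⟨i, rfl⟩
        rw [map_sub, sub_eq_zero, map_pow] at this
        exact this
      have hpq : MvPolynomial.aeval q p = Ideal.Quotient.mk I p := by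
        have : MvPolynomial.aeval q = Ideal.Quotient.mkₐ R I := by
          apply MvPolynomial.algHom_ext; intro i; simp [q]
        rw [this]; rfl
      have hs := span_monomials hN a q hq p
      rw [Submodule.mem_span_range_iff_exists_fun] at hs
      obtain ⟨c, hc⟩ := hs
      have hIle : ∀ r ∈ I, MvPolynomial.aeval y r = 0 := by
        intro r hr
        have hle : I ≤ RingHom.ker (MvPolynomial.aeval (R := R) y).toRingHom := by
          rw [hI, Ideal.span_le]
          rintro _ ⟨i, rfl⟩
          simp [RingHom.mem_ker, hyR]
        exact hle hr
      let ev : MvPolynomial ι R ⧸ I →ₐ[R] Ω := Ideal.Quotient.liftₐ I (MvPolynomial.aeval y) hIle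
      have hev : ∀ i, ev (q i) = y i := fun i => by
        exact MvPolynomial.aeval_X y i
      -- linear independence of the monomials over the fraction field
      have hfin : Module.finrank E (IntermediateField.adjoin E (Set.range y))
          = N ^ Fintype.card ι := by
        have := finrank_step hN a φ hφ hne h0 h1 y hy Finset.univ
        rwa [Finset.coe_univ, Set.image_univ, Finset.card_univ] at this
      let F := IntermediateField.adjoin E (Set.range y)
      let yF : ι → F := fun i => ⟨y i, IntermediateField.subset_adjoin _ _ ⟨i, rfl⟩⟩
      have hyF : ∀ i, yF i ^ N = algebraMap E F (algebraMap R E (a i)) := fun i =>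
        Subtype.ext (hy i)
      have hspan : ⊤ ≤ Submodule.span E
          (Set.range fun e : ι → Fin N => ∏ i, yF i ^ (e i : ℕ)) := by
        rintro ⟨z, hz⟩ -
        have halg : ∀ x ∈ Set.range y, IsAlgebraic E x := fun x _ =>
          Algebra.IsAlgebraic.isAlgebraic x
        have hz' : z ∈ Algebra.adjoin E (Set.range y) := by
          rw [← IntermediateField.adjoin_toSubalgebra_of_isAlgebraic halg]
          exact hz
        rw [Algebra.adjoin_range_eq_range_aeval] at hz'
        obtain ⟨P, rfl⟩ := hz'
        have := span_monomials hN _ yF hyF P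
        convert this using 1
        apply Subtype.ext
        have hcomp : (F.val.comp (MvPolynomial.aeval yF)) = MvPolynomial.aeval y := by
          apply MvPolynomial.algHom_ext
          intro i
          simp [yF]
        exact (DFunLike.congr_fun hcomp P).symm
      have hli := linearIndependent_of_top_le_span_of_card_eq_finrank hspan (by
        rw [hfin]; simp)
      have hrel : ∑ e : ι → Fin N, algebraMap R E (c e) • (∏ i, yF i ^ (e i : ℕ)) = 0 := by
        apply Subtype.ext
        have h5 := congrArg ev hc
        rw [hpq] at h5
        have h6 : ev (Ideal.Quotient.mk I p) = MvPolynomial.aeval y p := rfl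
        rw [h6, hp0, map_sum] at h5
        change F.val _ = 0
        rw [map_sum, ← h5]
        refine Finset.sum_congr rfl fun e _ => ?_
        rw [map_smul, map_smul, map_prod, map_prod, algebraMap_smul]
        congr 1
        refine Finset.prod_congr rfl fun i _ => ?_
        rw [map_pow, map_pow, hev]
        rfl
      have hc0 : ∀ e, c e = 0 := fun e => by
        have := Fintype.linearIndependent_iff.1 hli (fun e => algebraMap R E (c e)) hrel e
        exact (IsFractionRing.injective R E) (by simpa using this)
      rw [← Ideal.Quotient.eq_zero_iff_mem, ← hpq, ← hc]
      simp [hc0]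
  rw [hker]
  exact RingHom.ker_isPrime _

/-! ### The curves -/

/-- The parameters: positive integers `N`, `n` and pairwise distinct nonzero algebraic numbers
`λ₁, …, λₙ`. -/
structure Datum where
  N : ℕ
  n : ℕ
  N_pos : 0 < N
  n_pos : 0 < n
  lam : Fin n → AlgebraicClosure ℚ
  lam_ne_zero : ∀ i, lam i ≠ 0
  lam_injective : Function.Injective lam

namespace Datum

variable (D : Datum)

/-- The polynomial `Φ(T) = T ∏ (T - λᵢ) - 1` over the algebraic numbers. -/
def Phi : (AlgebraicClosure ℚ)[X] := X * (∏ i, (X - C (D.lam i))) - 1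

/-- The field `k_X = ℚ(λ₁, …, λₙ)`. -/
def kX : IntermediateField ℚ (AlgebraicClosure ℚ) := IntermediateField.adjoin ℚ (Set.range D.lam)

/-- `λᵢ` as an element of `k_X`. -/
def lamX (i : Fin D.n) : D.kX := ⟨D.lam i, IntermediateField.subset_adjoin _ _ ⟨i, rfl⟩⟩

theorem lamX_ne_zero (i : Fin D.n) : D.lamX i ≠ 0 := fun h =>
  D.lam_ne_zero i (congrArg Subtype.val h)

theorem lamX_injective : Function.Injective D.lamX := fun _ _ h =>
  D.lam_injective (congrArg Subtype.val h)

/-- The automorphisms of `k_X` that permute `λ₁, …, λₙ`. -/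
def permGroup : Subgroup (D.kX ≃ₐ[ℚ] D.kX) where
  carrier := {σ | ∃ π : Equiv.Perm (Fin D.n), ∀ i, σ (D.lamX i) = D.lamX (π i)}
  one_mem' := ⟨1, fun _ => rfl⟩
  mul_mem' := by
    rintro σ τ ⟨π, hπ⟩ ⟨ρ, hρ⟩
    exact ⟨π * ρ, fun i => by rw [AlgEquiv.mul_apply, hρ, hπ, Equiv.Perm.mul_apply]⟩
  inv_mem' := by
    rintro σ ⟨π, hπ⟩
    refine ⟨π⁻¹, fun i => ?_⟩
    have h : σ (D.lamX (π⁻¹ i)) = D.lamX i := by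
      rw [hπ]
      exact congrArg D.lamX (π.apply_symm_apply i)
    rw [← h]
    exact AlgEquiv.symm_apply_apply σ _

/-- The field `k_E = ℚ(λ₁, …, λₙ)^{Sₙ}` of elements of `k_X` that are fixed by all automorphisms
permuting the `λᵢ`. -/
def kE : IntermediateField ℚ D.kX := IntermediateField.fixedField D.permGroup

/-- The polynomial `f(X) = X (X - λ₁) ⋯ (X - λₙ)` over `k_X`. -/
def fX : (D.kX)[X] := X * ∏ i, (X - C (D.lamX i))

theorem fX_coeff_mem (m : ℕ) : D.fX.coeff m ∈ D.kE := by
  rw [kE, IntermediateField.mem_fixedField_iff]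
  rintro σ ⟨π, hπ⟩
  have hmap : D.fX.map (σ : D.kX →+* D.kX) = D.fX := by
    simp only [fX, Polynomial.map_mul, Polynomial.map_X, Polynomial.map_prod, Polynomial.map_sub,
      Polynomial.map_C, RingHom.coe_coe, hπ]
    congr 1
    exact Equiv.prod_comp π fun i => X - C (D.lamX i)
  have h := congrArg (fun q => Polynomial.coeff q m) hmap
  simpa only [Polynomial.coeff_map, RingHom.coe_coe] using h

/-- The polynomial `f(X) = X (X - λ₁) ⋯ (X - λₙ)`, whose coefficients lie in `k_E`, over `k_E`. -/
def fE : (D.kE)[X] :=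
  ∑ m ∈ D.fX.support, Polynomial.monomial m (⟨D.fX.coeff m, D.fX_coeff_mem m⟩ : D.kE)

theorem map_fE : D.fE.map (algebraMap D.kE D.kX) = D.fX := by
  rw [fE, Polynomial.map_sum]
  simp only [Polynomial.map_monomial]
  exact D.fX.sum_monomial_eq

/-- The ideal of `k_X[x][y₁, …, yₙ]` generated by the `x ^ N + (-1) ^ n * yᵢ ^ N - λᵢ`. -/
def idealX : Ideal (MvPolynomial (Fin D.n) (D.kX)[X]) :=
  Ideal.span (Set.range fun i =>
    MvPolynomial.C (X ^ D.N) + (-1) ^ D.n * MvPolynomial.X i ^ D.N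
      - MvPolynomial.C (C (D.lamX i)))

/-- The affine coordinate ring of the generalized Fermat curve `X_{N,n}` over `k_X`. -/
def ringX : Type := MvPolynomial (Fin D.n) (D.kX)[X] ⧸ D.idealX

instance : CommRing D.ringX :=
  inferInstanceAs (CommRing (MvPolynomial (Fin D.n) (D.kX)[X] ⧸ D.idealX))

instance : Algebra D.kX D.ringX :=
  inferInstanceAs (Algebra D.kX (MvPolynomial (Fin D.n) (D.kX)[X] ⧸ D.idealX))

/-- The quotient map onto the coordinate ring. -/
def mkX : MvPolynomial (Fin D.n) (D.kX)[X] →+* D.ringX := Ideal.Quotient.mk D.idealX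

theorem idealX_isPrime : D.idealX.IsPrime := by
  choose α hα using fun i => IsAlgClosed.exists_pow_nat_eq (D.lam i) D.N_pos
  have hα0 : ∀ i, α i ≠ 0 := by
    intro i h
    have h2 := hα i
    rw [h, zero_pow D.N_pos.ne'] at h2
    exact D.lam_ne_zero i h2.symm
  let a : Fin D.n → (D.kX)[X] := fun i => C ((-1) ^ D.n) * (C (D.lamX i) - X ^ D.N)
  let φ : Fin D.n → (D.kX)[X] →+* PowerSeries (AlgebraicClosure ℚ) := fun i =>
    Polynomial.coeToPowerSeries.ringHom.comp ((Polynomial.taylorAlgHom (α i)).toRingHom.comp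
      (Polynomial.mapRingHom (algebraMap D.kX (AlgebraicClosure ℚ))))
  have hφv : ∀ i r, φ i r = ((Polynomial.taylor (α i)
      (r.map (algebraMap D.kX (AlgebraicClosure ℚ))) : (AlgebraicClosure ℚ)[X]) :
        PowerSeries (AlgebraicClosure ℚ)) := fun i r => rfl
  have hlam : ∀ j, algebraMap D.kX (AlgebraicClosure ℚ) (D.lamX j) = D.lam j := fun j => rfl
  have hamap : ∀ j, (a j).map (algebraMap D.kX (AlgebraicClosure ℚ))
      = C ((-1) ^ D.n) * (C (D.lam j) - X ^ D.N) := by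
    intro j
    simp [a, hlam]
  have hc0 : ∀ i j, PowerSeries.constantCoeff (φ i (a j))
      = (-1) ^ D.n * (D.lam j - D.lam i) := by
    intro i j
    rw [hφv, ← PowerSeries.coeff_zero_eq_constantCoeff_apply, Polynomial.coeff_coe,
      Polynomial.taylor_coeff_zero, hamap]
    simp [hα]
  refine isPrime_kummerIdeal D.N_pos a φ ?_ ?_ ?_ ?_ D.idealX ?_
  · intro i r s hrs
    rw [hφv, hφv] at hrs
    exact Polynomial.map_injective _ (RingHom.injective _)
      (Polynomial.taylor_injective _ (Polynomial.coe_injective _ hrs))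
  · intro i j hji
    rw [hc0]
    exact mul_ne_zero (pow_ne_zero _ (by norm_num))
      (sub_ne_zero.2 fun h => hji (D.lam_injective h))
  · intro i
    rw [hc0, sub_self, mul_zero]
  · intro i
    rw [hφv, Polynomial.coeff_coe, Polynomial.taylor_coeff_one, hamap]
    have hc : ((-1 : AlgebraicClosure ℚ) ^ D.n) ≠ 0 := pow_ne_zero _ (by norm_num)
    generalize ((-1 : AlgebraicClosure ℚ) ^ D.n) = c at hc
    simp [Polynomial.derivative_X_pow, hc, hα0, D.N_pos.ne']
  · have hsq : ((-1 : MvPolynomial (Fin D.n) (D.kX)[X]) ^ D.n) * (-1) ^ D.n = 1 := by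
      have hm : (-1 : MvPolynomial (Fin D.n) (D.kX)[X]) * (-1) = 1 := by ring
      rw [← mul_pow, hm, one_pow]
    have hgen : ∀ i, (MvPolynomial.C (X ^ D.N) + (-1) ^ D.n * MvPolynomial.X i ^ D.N
        - MvPolynomial.C (C (D.lamX i)) : MvPolynomial (Fin D.n) (D.kX)[X])
        = (-1) ^ D.n * (MvPolynomial.X i ^ D.N - MvPolynomial.C (a i)) := by
      intro i
      simp only [a, map_mul, map_sub, map_pow, map_neg, map_one]
      linear_combination (MvPolynomial.C (C (D.lamX i)) - MvPolynomial.C X ^ D.N) * hsq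
    apply le_antisymm
    · refine Ideal.span_le.2 ?_
      rintro _ ⟨i, rfl⟩
      show _ ∈ Ideal.span _
      beta_reduce
      rw [hgen]
      exact Ideal.mul_mem_left _ _ (Ideal.subset_span ⟨i, rfl⟩)
    · refine Ideal.span_le.2 ?_
      rintro _ ⟨i, rfl⟩
      have h1 : (MvPolynomial.X i ^ D.N - MvPolynomial.C (a i))
          = (-1) ^ D.n * ((-1) ^ D.n * (MvPolynomial.X i ^ D.N - MvPolynomial.C (a i))) := by
        rw [← mul_assoc, hsq, one_mul]
      show (MvPolynomial.X i ^ D.N - MvPolynomial.C (a i)) ∈ D.idealX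
      rw [h1, ← hgen]
      exact Ideal.mul_mem_left _ _ (Ideal.subset_span ⟨i, rfl⟩)

instance : IsDomain D.ringX :=
  (Ideal.Quotient.isDomain_iff_prime D.idealX).2 D.idealX_isPrime

/-- The function field `k_X(X_{N,n})`. -/
def functionFieldX : Type := FractionRing D.ringX

instance : Field D.functionFieldX := inferInstanceAs (Field (FractionRing D.ringX))

instance : Algebra D.ringX D.functionFieldX :=
  inferInstanceAs (Algebra D.ringX (FractionRing D.ringX))

instance : Algebra D.kX D.functionFieldX :=
  inferInstanceAs (Algebra D.kX (FractionRing D.ringX))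

instance : IsScalarTower D.kX D.ringX D.functionFieldX :=
  inferInstanceAs (IsScalarTower D.kX D.ringX (FractionRing D.ringX))

instance : IsFractionRing D.ringX D.functionFieldX :=
  inferInstanceAs (IsFractionRing D.ringX (FractionRing D.ringX))

/-- The coordinate `x`, in the coordinate ring. -/
def xRing : D.ringX := D.mkX (MvPolynomial.C X)

/-- The coordinate `yᵢ`, in the coordinate ring. -/
def yRing (i : Fin D.n) : D.ringX := D.mkX (MvPolynomial.X i)

/-- The rational function `x` on `X_{N,n}`. -/
def x : D.functionFieldX := algebraMap D.ringX D.functionFieldX D.xRing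

/-- The rational function `yᵢ` on `X_{N,n}`. -/
def y (i : Fin D.n) : D.functionFieldX := algebraMap D.ringX D.functionFieldX (D.yRing i)

/-- Every algebraic number is the `x`-coordinate of a point of the affine curve. -/
theorem exists_pointX (c : AlgebraicClosure ℚ) :
    ∃ ev : D.ringX →+* AlgebraicClosure ℚ, ev D.xRing = c := by
  choose b hb using fun i =>
    IsAlgClosed.exists_pow_nat_eq ((-1) ^ D.n * (D.lam i - c ^ D.N)) D.N_pos
  let ev₀ : MvPolynomial (Fin D.n) (D.kX)[X] →+* AlgebraicClosure ℚ :=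
    MvPolynomial.eval₂Hom (Polynomial.eval₂RingHom (algebraMap D.kX (AlgebraicClosure ℚ)) c) b
  have hlam : ∀ j, algebraMap D.kX (AlgebraicClosure ℚ) (D.lamX j) = D.lam j := fun j => rfl
  have hev : ∀ r ∈ D.idealX, ev₀ r = 0 := by
    intro r hr
    have hle : D.idealX ≤ RingHom.ker ev₀ := by
      refine Ideal.span_le.2 ?_
      rintro _ ⟨i, rfl⟩
      show ev₀ _ = 0
      have hsq : ((-1 : AlgebraicClosure ℚ) ^ D.n) * (-1) ^ D.n = 1 := by
        rw [← mul_pow, neg_mul_neg, one_mul, one_pow]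
      simp only [ev₀, map_sub, map_add, map_mul, map_pow, map_neg, map_one,
        MvPolynomial.eval₂Hom_C, MvPolynomial.eval₂Hom_X', Polynomial.coe_eval₂RingHom,
        Polynomial.eval₂_X, Polynomial.eval₂_C, hb, hlam]
      linear_combination (D.lam i - c ^ D.N) * hsq
    exact hle hr
  refine ⟨Ideal.Quotient.lift _ ev₀ hev, ?_⟩
  show ev₀ (MvPolynomial.C X) = c
  simp [ev₀]

theorem x_ne_zero : D.x ≠ 0 := by
  intro h
  have h0 : D.xRing = 0 := IsFractionRing.injective D.ringX D.functionFieldX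
    (h.trans (map_zero (algebraMap _ _)).symm)
  obtain ⟨ev, hev⟩ := D.exists_pointX 1
  rw [h0, map_zero] at hev
  exact zero_ne_one hev

theorem one_sub_ne_zero : 1 - D.x * ∏ i, D.y i ≠ 0 := by
  intro h
  have h0 : 1 - D.xRing * ∏ i, D.yRing i = 0 := by
    apply IsFractionRing.injective D.ringX D.functionFieldX
    rw [map_sub, map_one, map_mul, map_prod, map_zero]
    exact h
  obtain ⟨ev, hev⟩ := D.exists_pointX 0
  have h1 := congrArg ev h0
  rw [map_sub, map_mul, hev, zero_mul, map_one, sub_zero, map_zero] at h1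
  exact one_ne_zero h1

/-- The symbol `ξ = {1 - x y₁ ⋯ yₙ, x}` in `K₂ᴹ(k_X(X_{N,n}))`. -/
def xi : MilnorK2 D.functionFieldX :=
  symbol (Units.mk0 (1 - D.x * ∏ i, D.y i) D.one_sub_ne_zero) (Units.mk0 D.x D.x_ne_zero)

/-- The equation `Y ^ N - f(X)` in `k_E[X][Y]`. -/
def polyE : (D.kE)[X][X] := X ^ D.N - C D.fE

/-- The affine coordinate ring `k_E[X, Y] / (Y ^ N - f(X))` of the superelliptic curve `E_{N,n}`. -/
def ringE : Type := AdjoinRoot D.polyE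

instance : CommRing D.ringE := inferInstanceAs (CommRing (AdjoinRoot D.polyE))

instance : Algebra D.kE D.ringE := inferInstanceAs (Algebra D.kE (AdjoinRoot D.polyE))

theorem fE_coeff_zero : D.fE.coeff 0 = 0 := by
  apply (algebraMap D.kE D.kX).injective
  rw [← Polynomial.coeff_map, map_fE, map_zero, fX, Polynomial.coeff_X_mul_zero]

theorem fE_coeff_one : D.fE.coeff 1 ≠ 0 := by
  intro h
  have h2 := congrArg (algebraMap D.kE D.kX) h
  rw [← Polynomial.coeff_map, map_fE, map_zero, fX, Polynomial.coeff_X_mul,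
    Polynomial.coeff_zero_eq_eval_zero, Polynomial.eval_prod, Finset.prod_eq_zero_iff] at h2
  obtain ⟨i, -, hi⟩ := h2
  exact D.lamX_ne_zero i (by simpa using hi)

theorem polyE_irreducible : Irreducible D.polyE := by
  have hmonic : D.polyE.Monic := monic_X_pow_sub_C _ D.N_pos.ne'
  have hdeg : D.polyE.degree = D.N := degree_X_pow_sub_C D.N_pos _
  have hP : (Ideal.span {(X : (D.kE)[X])}).IsPrime :=
    (Ideal.span_singleton_prime Polynomial.X_ne_zero).2 Polynomial.prime_X
  refine irreducible_of_eisenstein_criterion hP ?_ ?_ ?_ ?_ hmonic.isPrimitive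
  · rw [hmonic.leadingCoeff, ← Ideal.ne_top_iff_one]
    exact hP.ne_top
  · intro m hm
    rw [hdeg, Nat.cast_lt] at hm
    rw [polyE, coeff_sub, coeff_X_pow, if_neg hm.ne, zero_sub, neg_mem_iff, coeff_C]
    split_ifs
    · exact Ideal.mem_span_singleton.2 (Polynomial.X_dvd_iff.2 D.fE_coeff_zero)
    · exact zero_mem _
  · rw [hdeg]; exact_mod_cast D.N_pos
  · rw [polyE, coeff_sub, coeff_X_pow, if_neg D.N_pos.ne, zero_sub, neg_mem_iff, coeff_C_zero,
      Ideal.span_singleton_pow, Ideal.mem_span_singleton, Polynomial.X_pow_dvd_iff]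
    intro h
    exact D.fE_coeff_one (h 1 one_lt_two)

instance : IsDomain D.ringE := AdjoinRoot.isDomain_of_prime D.polyE_irreducible.prime

/-- The function field `k_E(E_{N,n})`. -/
def functionFieldE : Type := FractionRing D.ringE

instance : Field D.functionFieldE := inferInstanceAs (Field (FractionRing D.ringE))

instance : Algebra D.ringE D.functionFieldE :=
  inferInstanceAs (Algebra D.ringE (FractionRing D.ringE))

instance : Algebra D.kE D.functionFieldE :=
  inferInstanceAs (Algebra D.kE (FractionRing D.ringE))

instance : IsScalarTower D.kE D.ringE D.functionFieldE :=
  inferInstanceAs (IsScalarTower D.kE D.ringE (FractionRing D.ringE))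

instance : IsFractionRing D.ringE D.functionFieldE :=
  inferInstanceAs (IsFractionRing D.ringE (FractionRing D.ringE))

/-- The coordinate `X`, in the coordinate ring. -/
def XRing : D.ringE := AdjoinRoot.of D.polyE X

/-- The coordinate `Y`, in the coordinate ring. -/
def YRing : D.ringE := AdjoinRoot.root D.polyE

/-- The rational function `X` on `E_{N,n}`. -/
def XE : D.functionFieldE := algebraMap D.ringE D.functionFieldE D.XRing

/-- The rational function `Y` on `E_{N,n}`. -/
def YE : D.functionFieldE := algebraMap D.ringE D.functionFieldE D.YRing

/-- Every element of `k_E` is the `X`-coordinate of a point of the affine curve. -/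
theorem exists_pointE (c : D.kE) : ∃ (L : Type) (_ : Field L) (_ : Algebra D.kE L)
    (ev : D.ringE →+* L), ev D.XRing = algebraMap D.kE L c ∧
      ev D.YRing ^ D.N = algebraMap D.kE L (D.fE.eval c) := by
  let L := AlgebraicClosure D.kE
  obtain ⟨b, hb⟩ := IsAlgClosed.exists_pow_nat_eq (algebraMap D.kE L (D.fE.eval c)) D.N_pos
  have hroot : D.polyE.eval₂ (Polynomial.eval₂RingHom (algebraMap D.kE L) (algebraMap D.kE L c)) b
      = 0 := by
    simp [polyE, hb, Polynomial.eval₂_at_apply]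
  refine ⟨L, inferInstance, inferInstance, AdjoinRoot.lift _ b hroot, ?_, ?_⟩
  · refine (AdjoinRoot.lift_of hroot).trans ?_
    simp
  · exact (congrArg (· ^ D.N) (AdjoinRoot.lift_root hroot)).trans hb

theorem XE_ne_zero : D.XE ≠ 0 := by
  intro h
  have h0 : D.XRing = 0 := IsFractionRing.injective D.ringE D.functionFieldE
    (h.trans (map_zero (algebraMap _ _)).symm)
  obtain ⟨L, _, _, ev, hev, -⟩ := D.exists_pointE 1
  rw [h0, map_zero, map_one] at hev
  exact zero_ne_one hev

theorem one_sub_YE_ne_zero : 1 - D.YE ≠ 0 := by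
  intro h
  have h0 : 1 - D.YRing = 0 := by
    apply IsFractionRing.injective D.ringE D.functionFieldE
    rw [map_sub, map_one, map_zero]
    exact h
  obtain ⟨L, _, _, ev, -, hev⟩ := D.exists_pointE 0
  rw [← sub_eq_zero.1 h0, map_one, one_pow, ← Polynomial.coeff_zero_eq_eval_zero, fE_coeff_zero,
    map_zero] at hev
  exact one_ne_zero hev

/-- The symbol `{1 - Y, X}` in `K₂ᴹ(k_E(E_{N,n}))`. -/
def xiE : MilnorK2 D.functionFieldE :=
  symbol (Units.mk0 (1 - D.YE) D.one_sub_YE_ne_zero) (Units.mk0 D.XE D.XE_ne_zero)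

end Datum

end GenFermat

end

/-! Both curves carry functions satisfying `Y ^ N = f(s)` with `f(T) = T ∏ (T - λᵢ)`: on `E_{N,n}`
take `s = X`, on `X_{N,n}` take `s = x ^ N` and `Y = x y₁ ⋯ yₙ`. So one local computation,
`tamePair_pow_eq_one_of_pow_eq_aeval`, shows that the tame symbol of `{1 - Y, s}` is torsion of
uniformly bounded order at every closed point.

At a zero of `s`, `f(0) = 0` makes `Y` vanish, so `1 - Y` has value 1 and the symbol is trivial. At
a pole of `s`, `1 - Y` behaves like `-Y` and `Y ^ N` like `s ^ deg f`, so up to sign and an `N`-th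
power the two entries are multiplicatively dependent. Elsewhere the symbol is a power of the value
of `s`, and it is nontrivial only where `Y` takes the value 1; there `f(s)` takes the value 1, so
the value of `s` is a zero of `Φ = f - 1`, hence a root of unity. This is the only use of the
hypothesis on `Φ`. It enters as the divisibility `f - 1 ∣ (T ^ m - 1) ^ r`, which makes sense over
`k_X` and `k_E` alike.

Bilinearity gives `{1 - Y, x ^ N} = N {1 - Y, x}`, which settles `ξ` and computes the pullback of
`{1 - Y, X}`. Torsion dies after tensoring with `ℚ`. The embedding of function fields exists because
`x ^ N` is transcendental over `k_X` and `k_E[X, Y] / (Y ^ N - f)` is integral over `k_E[X]`. -/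

noncomputable section

namespace GenFermat

/-! ### Local computation of the tame symbol at a closed point. -/

namespace ClosedPoint

variable {k F : Type*} [Field k] [Field F] [Algebra k F] (v : ClosedPoint k F)

theorem mem_principalUnitGroup_iff (u : Fˣ) :
    u ∈ v.val.valuationSubring.principalUnitGroup ↔ v.val ((u : F) - 1) < 1 := by
  rw [ValuationSubring.mem_principalUnitGroup_iff,
    ← (Valuation.isEquiv_valuation_valuationSubring v.val).lt_one_iff_lt_one]

theorem ord_eq_zero_of_mem_principalUnitGroup {u : Fˣ}
    (hu : u ∈ v.val.valuationSubring.principalUnitGroup) : v.ord u = 0 :=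
  (v.mem_unitGroup_iff u).1 (ValuationSubring.principal_units_le_units _ hu)

/-- Allows equalities of residues to be checked in `Fˣ` modulo the subgroup of principal units,
without handling elements of the residue field. -/
theorem tamePair_pow_eq_one {f g : Fˣ} {m : ℕ}
    (h : v.tameFun f g ^ m ∈ v.val.valuationSubring.principalUnitGroup) :
    v.tamePair f g ^ m = 1 := by
  rw [tamePair, ← map_pow]
  exact v.residue_eq_one _ ((v.mem_principalUnitGroup_iff _).1 h)

theorem val_algebraMap_le_one (c : k) : v.val (algebraMap k F c) ≤ 1 := by
  rcases eq_or_ne c 0 with rfl | hc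
  · simp
  · exact (v.trivial_on c hc).le

theorem val_aeval_le_one (q : k[X]) {t : F} (ht : v.val t ≤ 1) : v.val (aeval t q) ≤ 1 := by
  induction q using Polynomial.induction_on' with
  | add p q hp hq => rw [map_add]; exact (v.val.map_add _ _).trans (max_le hp hq)
  | monomial m c =>
    rw [aeval_monomial, map_mul, map_pow]
    exact mul_le_one' (v.val_algebraMap_le_one c) (pow_le_one' ht m)

/-- `q(t) - q(0)` is `t` times a polynomial in `t`, and the latter is integral at `v`. -/
theorem val_aeval_sub_lt_one (q : k[X]) {t : F} (ht : v.val t < 1) :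
    v.val (aeval t q - algebraMap k F (q.coeff 0)) < 1 := by
  have h : aeval t q - algebraMap k F (q.coeff 0) = aeval t q.divX * t := by
    conv_lhs => rw [← q.divX_mul_X_add]
    simp
  rw [h, map_mul]
  exact (mul_le_of_le_one_left' (v.val_aeval_le_one _ ht.le)).trans_lt ht

/-- At a pole of `t`, a monic polynomial in `t` is asymptotic to its leading monomial. -/
theorem val_aeval_div_pow_sub_one_lt_one {q : k[X]} (hq : q.Monic) {t : F} (ht0 : t ≠ 0)
    (ht : v.val t⁻¹ < 1) : v.val (aeval t q / t ^ q.natDegree - 1) < 1 := by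
  let _ := invertibleOfNonzero ht0
  -- `q(t) / t ^ deg q` is the reversed polynomial evaluated at `t⁻¹`, and its constant term is the
  -- leading coefficient 1.
  have h := eval₂_reverse_mul_pow (algebraMap k F) t q
  have h1 := v.val_aeval_sub_lt_one q.reverse ht
  rw [coeff_zero_reverse, hq.leadingCoeff, map_one] at h1
  rw [invOf_eq_inv] at h
  rwa [aeval_def, ← h, mul_div_cancel_right₀ _ (pow_ne_zero _ ht0)]

/-- The tame symbol of `{1 - Y, X}` is torsion at every point of a curve `Y ^ N = f(X)` for which all
zeros of `f - 1` are roots of unity. -/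
theorem tamePair_pow_eq_one_of_pow_eq_aeval {f : k[X]} (hf : f.Monic) (hf0 : f.coeff 0 = 0)
    {m r N : ℕ} (hN : 0 < N) (hdvd : f - 1 ∣ (X ^ m - 1) ^ r) {s : Fˣ} {Y : F} {u : Fˣ}
    (hu : (u : F) = 1 - Y) (hY : Y ^ N = aeval (s : F) f) :
    v.tamePair u s ^ (2 * N * m) = 1 := by
  apply v.tamePair_pow_eq_one
  set P := v.val.valuationSubring.principalUnitGroup with hP
  have hNY : v.val Y ^ N = v.val (aeval (s : F) f) := by rw [← map_pow, hY]
  rcases lt_trichotomy (v.ord s) 0 with hs | hs | hs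
  -- The factor `2 * N` of the exponent is what this case needs; `m` serves only the points where
  -- `s` is a unit.
  · -- a pole of `X`
    have hsinv : v.val (s : F)⁻¹ < 1 := by
      have := v.val_lt_one_of_ord_pos (f := s⁻¹) (by rw [v.ord_inv]; omega)
      simpa using this
    have h1 := v.val_aeval_div_pow_sub_one_lt_one hf s.ne_zero hsinv
    rw [← hY] at h1
    have hY0 : Y ≠ 0 := by
      rintro rfl
      rw [zero_pow hN.ne', zero_div, zero_sub, Valuation.map_neg, map_one] at h1
      exact lt_irrefl _ h1
    let y : Fˣ := Units.mk0 Y hY0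
    have hyP : y ^ N / s ^ f.natDegree ∈ P := by
      rw [hP, v.mem_principalUnitGroup_iff]
      simpa [y] using h1
    have hord : N * v.ord y = f.natDegree * v.ord s := by
      have h2 := v.ord_eq_zero_of_mem_principalUnitGroup hyP
      rw [div_eq_mul_inv, v.ord_mul, v.ord_inv, ← zpow_natCast, ← zpow_natCast, v.ord_zpow,
        v.ord_zpow] at h2
      linarith
    -- A monic constant is 1, which does not vanish at 0.
    have hd : 0 < f.natDegree := by
      by_contra hd
      have h2 := (Monic.natDegree_eq_zero hf).1 (by omega)
      rw [h2] at hf0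
      simp at hf0
    have hyneg : v.ord y < 0 := by
      have h2 : (f.natDegree : ℤ) * v.ord s < 0 := mul_neg_of_pos_of_neg (by exact_mod_cast hd) hs
      rw [← hord] at h2
      exact (pos_iff_neg_of_mul_neg h2).1 (by exact_mod_cast hN)
    -- `(1 - Y) / (-Y) = 1 - Y⁻¹`, and `Y` has a pole.
    have huP : u / -y ∈ P := by
      rw [hP, v.mem_principalUnitGroup_iff]
      have h2 : ((u / -y : Fˣ) : F) - 1 = -((y⁻¹ : Fˣ) : F) := by
        rw [Units.val_div_eq_div_val, Units.val_neg, Units.val_inv_eq_inv_val, hu, Units.val_mk0]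
        field_simp
        ring
      rw [h2, Valuation.map_neg]
      exact v.val_lt_one_of_ord_pos (by rw [v.ord_inv]; omega)
    -- The even exponent removes the sign of `-Y`.
    have hq : u ^ (2 * N) / s ^ (2 * f.natDegree) ∈ P := by
      have h2 := mul_mem (pow_mem huP (2 * N)) (pow_mem hyP 2)
      convert h2 using 1
      rw [div_pow, div_pow, (even_two_mul N).neg_pow, ← pow_mul, ← pow_mul, mul_comm N 2,
        mul_comm f.natDegree 2, div_mul_div_cancel]
    have hord2 : N * v.ord u = f.natDegree * v.ord s := by
      have h2 := v.ord_eq_zero_of_mem_principalUnitGroup hq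
      rw [div_eq_mul_inv, v.ord_mul, v.ord_inv, ← zpow_natCast, ← zpow_natCast, v.ord_zpow,
        v.ord_zpow] at h2
      push_cast at h2
      linarith
    rw [pow_mul]
    apply pow_mem
    -- The even exponent also kills the sign in the tame symbol, and `hord2` turns `s ^ (2 * N * ord
    -- u)` into `s ^ (2 * deg f * ord s)`.
    convert zpow_mem hq (v.ord s) using 1
    rw [tameFun, mul_pow, ← zpow_natCast (_ ^ (_ : ℤ)), ← zpow_mul,
      Even.neg_one_zpow (by push_cast; exact ((even_two_mul (N : ℤ)).mul_left _)), one_mul,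
      div_pow, div_zpow]
    congr 1
    · rw [← zpow_natCast, ← zpow_natCast, ← zpow_mul, ← zpow_mul, mul_comm]
    · rw [← zpow_natCast, ← zpow_natCast, ← zpow_mul, ← zpow_mul]
      congr 1
      push_cast
      linarith
  -- Here `s` is a unit and `Y` is integral, so the symbol can be nontrivial only where `1 - Y`
  -- vanishes.
  · have hs1 : v.val (s : F) = 1 := by rw [v.val_eq, hs]; simp
    have hYle : v.val Y ≤ 1 := by
      rw [← pow_le_one_iff hN.ne', hNY]
      exact v.val_aeval_le_one _ hs1.le
    rcases eq_or_ne (v.ord u) 0 with hu0 | hu0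
    · have : v.tameFun u s = 1 := by simp [tameFun, hs, hu0]
      rw [this, one_pow]
      exact one_mem _
    have hule : v.val (1 - Y) ≤ 1 :=
      (v.val.map_sub _ _).trans (max_le (map_one v.val).le hYle)
    have hult : v.val (1 - Y) < 1 := by
      refine lt_of_le_of_ne hule fun h => hu0 ?_
      rw [ord, hu, h, WithZero.log_one, neg_zero]
    have hY0 : Y ≠ 0 := by
      rintro rfl
      simp at hult
    let y : Fˣ := Units.mk0 Y hY0
    have hyP : y ∈ P := by
      rw [hP, v.mem_principalUnitGroup_iff, Valuation.map_sub_swap]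
      exact hult
    have hf1 : v.val (aeval (s : F) (f - 1)) < 1 := by
      have h2 := (v.mem_principalUnitGroup_iff _).1 (pow_mem hyP N)
      rw [Units.val_pow_eq_pow_val, Units.val_mk0, hY] at h2
      simpa using h2
    -- `(s ^ m - 1) ^ r` is `f(s) - 1`, of positive order, times an integral factor; hence `s ^ m -
    -- 1` itself has positive order.
    have hsP : s ^ m ∈ P := by
      obtain ⟨q, hq⟩ := hdvd
      have h2 : v.val ((s : F) ^ m - 1) ^ r < 1 := by
        have h3 := congrArg (fun p => v.val (aeval (s : F) p)) hq
        simp only [map_pow, map_mul, map_sub, map_one, aeval_X] at h3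
        rw [h3]
        simp only [map_sub, map_one] at hf1
        exact (mul_le_of_le_one_right' (v.val_aeval_le_one q hs1.le)).trans_lt hf1
      rw [hP, v.mem_principalUnitGroup_iff, Units.val_pow_eq_pow_val]
      by_contra h3
      exact absurd h2 (not_lt.2 (one_le_pow_of_one_le' (not_lt.1 h3) r))
    have h4 : v.tameFun u s = (s ^ v.ord u)⁻¹ := by simp [tameFun, hs]
    have h5 : v.tameFun u s ^ (2 * N * m) = (s ^ m) ^ (-(v.ord u) * (2 * N)) := by
      rw [h4, ← zpow_neg, ← zpow_natCast, ← zpow_natCast, ← zpow_mul, ← zpow_mul]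
      congr 1
      push_cast
      ring
    rw [h5]
    exact zpow_mem hsP _
  -- At a zero of `s`, `Y ^ N = f(s)` vanishes because `f` has no constant term, so `u` is a
  -- principal unit.
  · have h1 := v.val_aeval_sub_lt_one f (v.val_lt_one_of_ord_pos hs)
    rw [hf0, map_zero, sub_zero, ← hNY, pow_lt_one_iff hN.ne'] at h1
    have huP : u ∈ P := by
      rw [hP, v.mem_principalUnitGroup_iff, hu, sub_sub_cancel_left, Valuation.map_neg]
      exact h1
    have h4 : v.tameFun u s = u ^ v.ord s := by
      simp [tameFun, v.ord_eq_zero_of_mem_principalUnitGroup huP]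
    rw [h4]
    exact pow_mem (zpow_mem huP _) _

end ClosedPoint

/-! ### From local torsion to the tame kernel and to rational coefficients. -/

section Symbols

variable {k F : Type*} [Field k] [Field F] [Algebra k F]

theorem symbol_pow_right (f g : Fˣ) (m : ℕ) : symbol f (g ^ m) = m • symbol f g := by
  rw [symbol, symbol, ofMul_pow, TensorProduct.tmul_smul, map_nsmul]

theorem MilnorK2.map_symbol {L : Type*} [Field L] (p : F →+* L) (f g : Fˣ) :
    MilnorK2.map p (symbol f g) = symbol (Units.map (p : F →* L) f) (Units.map (p : F →* L) g) :=
  rfl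

theorem nsmul_symbol_mem_tameKernel {f g : Fˣ} {m : ℕ}
    (h : ∀ v : ClosedPoint k F, v.tamePair f g ^ m = 1) : m • symbol f g ∈ tameKernel k F := by
  rw [tameKernel, Submodule.mem_iInf]
  intro v
  rw [LinearMap.mem_ker, map_nsmul, v.tame_symbol, ← ofMul_pow, h v, ofMul_one]

/-- Writing `1 = m • m⁻¹` in `ℚ` moves the multiple `m` across the tensor sign onto the tame symbol
of `ξ`, which it annihilates. -/
theorem one_tmul_mem_motivicH2 {ξ : MilnorK2 F} {m : ℕ} (hm : 0 < m)
    (h : m • ξ ∈ tameKernel k F) : (1 : ℚ) ⊗ₜ[ℤ] ξ ∈ motivicH2 k F := by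
  rw [tameKernel, Submodule.mem_iInf] at h
  rw [motivicH2, Submodule.mem_iInf]
  intro v
  have hv := h v
  rw [LinearMap.mem_ker, map_nsmul] at hv
  rw [LinearMap.mem_ker, LinearMap.baseChange_tmul]
  have hm0 : (m : ℚ) ≠ 0 := by exact_mod_cast hm.ne'
  have h1 : (1 : ℚ) = m • (m : ℚ)⁻¹ := by rw [nsmul_eq_mul, mul_inv_cancel₀ hm0]
  rw [h1, TensorProduct.smul_tmul, hv, TensorProduct.tmul_zero]

theorem nsmul_symbol_mem_tameKernel_of_pow_eq_aeval {f : k[X]} (hf : f.Monic)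
    (hf0 : f.coeff 0 = 0) {m r N : ℕ} (hN : 0 < N) (hdvd : f - 1 ∣ (X ^ m - 1) ^ r) {s : Fˣ}
    {Y : F} {u : Fˣ} (hu : (u : F) = 1 - Y) (hY : Y ^ N = aeval (s : F) f) :
    (2 * N * m) • symbol u s ∈ tameKernel k F :=
  nsmul_symbol_mem_tameKernel fun v =>
    v.tamePair_pow_eq_one_of_pow_eq_aeval hf hf0 hN hdvd hu hY

end Symbols

/-! ### The polynomial `f` and the divisibility encoding the hypothesis on `Φ`. -/

namespace Datum

variable (D : Datum)

theorem fX_monic : D.fX.Monic :=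
  monic_X.mul (monic_prod_of_monic _ _ fun _ _ => monic_X_sub_C _)

theorem fE_monic : D.fE.Monic := by
  have h := D.fX_monic
  rw [← D.map_fE] at h
  exact monic_of_injective (algebraMap D.kE D.kX).injective h

theorem map_fX_sub_one : (D.fX - 1).map (algebraMap D.kX (AlgebraicClosure ℚ)) = D.Phi := by
  have hlam : ∀ j, algebraMap D.kX (AlgebraicClosure ℚ) (D.lamX j) = D.lam j := fun _ => rfl
  simp [fX, Phi, Polynomial.map_prod, hlam]

/-- If the zeros of `Φ` are roots of unity, then `f - 1` divides a power of some `T ^ m - 1`. -/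
theorem exists_fX_sub_one_dvd (ν : Fin D.n → AlgebraicClosure ℚ)
    (hν : ∀ i, ∃ m : ℕ, 0 < m ∧ ν i ^ m = 1)
    (hΦ : D.Phi = (∏ i, (X - C (ν i))) * (X - C ((-1) ^ D.n * (∏ i, ν i)⁻¹))) :
    ∃ m r : ℕ, 0 < m ∧ D.fX - 1 ∣ (X ^ m - 1) ^ r := by
  choose e he0 he using hν
  have hνm : ∀ i, ν i ^ (2 * ∏ j, e j) = 1 := fun i => by
    obtain ⟨c, hc⟩ := (Finset.dvd_prod_of_mem e (Finset.mem_univ i)).mul_left 2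
    rw [hc, pow_mul, he, one_pow]
  -- The factor 2 absorbs the sign `(-1) ^ n` of the last root. The power `n + 1` gives one copy of
  -- `T ^ m - 1` to each linear factor, so repeated roots are harmless.
  refine ⟨2 * ∏ i, e i, D.n + 1, Nat.mul_pos two_pos (Finset.prod_pos fun i _ => he0 i), ?_⟩
  have hroot : ∀ c : AlgebraicClosure ℚ, c ^ (2 * ∏ j, e j) = 1 →
      X - C c ∣ X ^ (2 * ∏ j, e j) - 1 := fun c hc => by
    rw [dvd_iff_isRoot]
    simp [hc]
  rw [← Polynomial.map_dvd_map' (algebraMap D.kX (AlgebraicClosure ℚ)), map_fX_sub_one, hΦ,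
    pow_succ]
  simp only [Polynomial.map_mul, Polynomial.map_pow, Polynomial.map_sub, Polynomial.map_X,
    Polynomial.map_one]
  refine mul_dvd_mul ?_ (hroot _ ?_)
  · have h := Finset.prod_dvd_prod_of_dvd (fun i => X - C (ν i))
      (fun _ => (X ^ (2 * ∏ j, e j) - 1 : (AlgebraicClosure ℚ)[X])) (s := Finset.univ)
      fun i _ => hroot _ (hνm i)
    simpa using h
  · rw [mul_pow, inv_pow, ← Finset.prod_pow, Finset.prod_congr rfl fun i _ => hνm i,
      Finset.prod_const_one, inv_one, mul_one, ← pow_mul]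
    exact Even.neg_one_pow (by rw [mul_left_comm]; exact even_two_mul _)

/-- Divisibility of polynomials over a field can be tested after a field extension. -/
theorem fE_sub_one_dvd {m r : ℕ} (h : D.fX - 1 ∣ (X ^ m - 1) ^ r) :
    D.fE - 1 ∣ (X ^ m - 1) ^ r := by
  rw [← Polynomial.map_dvd_map' (algebraMap D.kE D.kX)]
  simpa [D.map_fE] using h

/-! ### The relation `Y ^ N = f(s)` on both curves. -/

theorem YE_pow : D.YE ^ D.N = aeval D.XE D.fE := by
  have h : D.YRing ^ D.N = AdjoinRoot.of D.polyE D.fE := by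
    have h1 := AdjoinRoot.eval₂_root D.polyE
    rw [polyE, eval₂_sub, eval₂_X_pow, eval₂_C, sub_eq_zero] at h1
    exact h1
  let ι : (D.kE)[X] →+* D.functionFieldE :=
    (algebraMap D.ringE D.functionFieldE).comp (AdjoinRoot.of D.polyE)
  have h2 : ι D.fE = aeval D.XE D.fE := by
    have h3 := hom_eval₂ D.fE C ι X
    rw [eval₂_C_X] at h3
    exact h3
  rw [YE, ← map_pow, h]
  exact h2

theorem xRing_pow_add (i : Fin D.n) :
    D.xRing ^ D.N + (-1) ^ D.n * D.yRing i ^ D.N = algebraMap D.kX D.ringX (D.lamX i) := by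
  have h : D.mkX (MvPolynomial.C (X ^ D.N) + (-1) ^ D.n * MvPolynomial.X i ^ D.N
      - MvPolynomial.C (C (D.lamX i))) = 0 :=
    Ideal.Quotient.eq_zero_iff_mem.2 (Ideal.subset_span ⟨i, rfl⟩)
  rw [map_sub, sub_eq_zero, map_add, map_mul, map_pow, map_pow, map_pow, map_neg, map_one,
    map_pow] at h
  exact h

/-- Each `yᵢ ^ N` is `(-1) ^ (n + 1) (x ^ N - λᵢ)`. The `n` signs multiply to `(-1) ^ (n (n + 1)) =
1`, which is the purpose of the sign in the equations of `X_{N,n}`. -/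
theorem x_mul_prod_y_pow : (D.x * ∏ i, D.y i) ^ D.N = aeval (D.x ^ D.N) D.fX := by
  have h : ∀ i, D.y i ^ D.N
      = (-1) ^ D.n * (-1) * (D.x ^ D.N - algebraMap D.kX D.functionFieldX (D.lamX i)) := fun i => by
    have h1 := congrArg (algebraMap D.ringX D.functionFieldX) (D.xRing_pow_add i)
    rw [← IsScalarTower.algebraMap_apply, map_add, map_mul, map_pow, map_pow, map_pow, map_neg,
      map_one] at h1
    have hsq : ((-1 : D.functionFieldX) ^ D.n) * (-1) ^ D.n = 1 := by
      rw [← mul_pow, neg_mul_neg, one_mul, one_pow]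
    change D.x ^ D.N + (-1) ^ D.n * D.y i ^ D.N = _ at h1
    linear_combination (-1) ^ D.n * h1 - D.y i ^ D.N * hsq
  have hsign : ((-1 : D.functionFieldX) ^ D.n * (-1)) ^ D.n = 1 := by
    rw [← pow_succ, ← pow_mul, mul_comm]
    exact (Nat.even_mul_succ_self _).neg_one_pow
  rw [mul_pow, ← Finset.prod_pow, Finset.prod_congr rfl fun i _ => h i]
  rw [Finset.prod_mul_distrib, Finset.prod_const, Finset.card_univ, Fintype.card_fin, hsign,
    one_mul, fX]
  simp

/-! ### The embedding of function fields. -/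

/-- The coordinate `x` is transcendental over `k_X`. -/
theorem mkX_comp_C_injective :
    Function.Injective (D.mkX.comp (MvPolynomial.C (σ := Fin D.n) (R := (D.kX)[X]))) := by
  let Ω := AlgebraicClosure (FractionRing (D.kX)[X])
  let j : (D.kX)[X] →+* Ω :=
    (algebraMap (FractionRing (D.kX)[X]) Ω).comp (algebraMap (D.kX)[X] (FractionRing (D.kX)[X]))
  have hj : Function.Injective j :=
    (algebraMap (FractionRing (D.kX)[X]) Ω).injective.comp
      (IsFractionRing.injective (D.kX)[X] (FractionRing (D.kX)[X]))
  -- Solving for the `yᵢ` in an algebraic closure of `k_X(x)` gives a point of the curve whose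
  -- coordinate `x` is the generic one; evaluation there already separates the polynomials in `x`.
  choose b hb using fun i =>
    IsAlgClosed.exists_pow_nat_eq (j ((-1) ^ D.n * (C (D.lamX i) - X ^ D.N))) D.N_pos
  let ev₀ : MvPolynomial (Fin D.n) (D.kX)[X] →+* Ω := MvPolynomial.eval₂Hom j b
  have hle : D.idealX ≤ RingHom.ker ev₀ := by
    refine Ideal.span_le.2 ?_
    rintro _ ⟨i, rfl⟩
    show ev₀ _ = 0
    have hsq : ((-1 : Ω) ^ D.n) * (-1) ^ D.n = 1 := by
      rw [← mul_pow, neg_mul_neg, one_mul, one_pow]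
    simp only [ev₀, map_sub, map_add, map_mul, map_pow, map_neg, map_one,
      MvPolynomial.eval₂Hom_C, MvPolynomial.eval₂Hom_X', hb]
    linear_combination (j (C (D.lamX i)) - j X ^ D.N) * hsq
  let ev : D.ringX →+* Ω := Ideal.Quotient.lift D.idealX ev₀ fun r hr => hle hr
  have hev : ∀ q : (D.kX)[X], ev (D.mkX (MvPolynomial.C q)) = j q := fun q =>
    MvPolynomial.eval₂Hom_C j b q
  intro q q' h
  apply hj
  rw [← hev, ← hev]
  exact congrArg ev h

/-- The homomorphism `k_E[X] → k_X(X_{N,n})` with `X ↦ x ^ N`. -/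
def polyToX : (D.kE)[X] →+* D.functionFieldX :=
  eval₂RingHom ((algebraMap D.kX D.functionFieldX).comp (algebraMap D.kE D.kX)) (D.x ^ D.N)

theorem polyToX_C (c : D.kE) :
    D.polyToX (C c) = algebraMap D.kX D.functionFieldX (algebraMap D.kE D.kX c) :=
  eval₂_C _ _

theorem polyToX_X : D.polyToX X = D.x ^ D.N := eval₂_X _ _

/-- The map factors into injections: extension of constants, the substitution `X ↦ X ^ N`, the
inclusion of `k_X[x]` in the coordinate ring, and passage to fractions. -/
theorem polyToX_injective : Function.Injective D.polyToX := by
  let q : (D.kE)[X] →+* D.functionFieldX :=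
    (algebraMap D.ringX D.functionFieldX).comp ((D.mkX.comp MvPolynomial.C).comp
      ((expand D.kX D.N).toRingHom.comp (mapRingHom (algebraMap D.kE D.kX))))
  have hq : D.polyToX = q := by
    apply Polynomial.ringHom_ext
    · intro c
      rw [polyToX_C]
      simp only [q, RingHom.comp_apply, coe_mapRingHom, map_C, AlgHom.toRingHom_eq_coe,
        RingHom.coe_coe, expand_C]
      exact IsScalarTower.algebraMap_apply D.kX D.ringX D.functionFieldX _
    · rw [polyToX_X]
      simp only [q, RingHom.comp_apply, coe_mapRingHom, map_X, AlgHom.toRingHom_eq_coe,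
        RingHom.coe_coe, expand_X, map_pow]
      rfl
  rw [hq]
  exact (IsFractionRing.injective D.ringX D.functionFieldX).comp (D.mkX_comp_C_injective.comp
    ((expand_injective D.N_pos).comp (map_injective _ (algebraMap D.kE D.kX).injective)))

theorem polyToX_fE : D.polyToX D.fE = (D.x * ∏ i, D.y i) ^ D.N := by
  rw [x_mul_prod_y_pow, ← D.map_fE, aeval_def, eval₂_map]
  rfl

theorem eval₂_polyE : D.polyE.eval₂ D.polyToX (D.x * ∏ i, D.y i) = 0 := by
  rw [polyE, eval₂_sub, eval₂_X_pow, eval₂_C, polyToX_fE, sub_self]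

/-- The pullback `(X, Y) ↦ (x ^ N, x y₁ ⋯ yₙ)` on the coordinate ring of `E_{N,n}`. -/
def ringEToX : D.ringE →+* D.functionFieldX :=
  AdjoinRoot.lift D.polyToX (D.x * ∏ i, D.y i) D.eval₂_polyE

theorem ringEToX_of (q : (D.kE)[X]) :
    D.ringEToX (AdjoinRoot.of D.polyE q) = D.polyToX q :=
  AdjoinRoot.lift_of D.eval₂_polyE

theorem ringEToX_YRing : D.ringEToX D.YRing = D.x * ∏ i, D.y i :=
  AdjoinRoot.lift_root D.eval₂_polyE

/-- In a domain integral over `k_E[X]`, an ideal meeting `k_E[X]` only in 0 is 0. So it suffices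
that the restriction `polyToX` is injective. -/
theorem ringEToX_injective : Function.Injective D.ringEToX := by
  have hdom : IsDomain (AdjoinRoot D.polyE) := AdjoinRoot.isDomain_of_prime D.polyE_irreducible.prime
  have hint : Algebra.IsIntegral (D.kE)[X] (AdjoinRoot D.polyE) :=
    have hmonic : D.polyE.Monic := monic_X_pow_sub_C _ D.N_pos.ne'
    have := hmonic.finite_adjoinRoot
    Algebra.IsIntegral.of_finite _ _
  rw [RingHom.injective_iff_ker_eq_bot]
  refine Ideal.eq_bot_of_comap_eq_bot (R := (D.kE)[X]) (S := AdjoinRoot D.polyE) ?_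
  rw [eq_bot_iff]
  intro q hq
  refine Ideal.mem_bot.2 (D.polyToX_injective ?_)
  rw [map_zero, ← ringEToX_of]
  exact hq

/-- The embedding `k_E(E_{N,n}) → k_X(X_{N,n})` of function fields. -/
def pullback : D.functionFieldE →+* D.functionFieldX :=
  IsFractionRing.lift D.ringEToX_injective

theorem pullback_algebraMap (r : D.ringE) :
    D.pullback (algebraMap D.ringE D.functionFieldE r) = D.ringEToX r :=
  IsFractionRing.lift_algebraMap D.ringEToX_injective r

theorem pullback_algebraMap_kE (c : D.kE) :
    D.pullback (algebraMap D.kE D.functionFieldE c)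
      = algebraMap D.kX D.functionFieldX (algebraMap D.kE D.kX c) := by
  rw [IsScalarTower.algebraMap_apply D.kE D.ringE D.functionFieldE, pullback_algebraMap,
    ← polyToX_C, ← ringEToX_of]
  rfl

theorem pullback_XE : D.pullback D.XE = D.x ^ D.N := by
  rw [XE, pullback_algebraMap, XRing, ringEToX_of, polyToX_X]

theorem pullback_YE : D.pullback D.YE = D.x * ∏ i, D.y i := by
  rw [YE, pullback_algebraMap, ringEToX_YRing]

theorem map_pullback_xiE : MilnorK2.map D.pullback D.xiE = D.N • D.xi := by
  rw [xiE, xi, MilnorK2.map_symbol, ← symbol_pow_right]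
  congr 1
  · ext
    simp [pullback_YE]
  · ext
    simp [pullback_XE]

/-! ### The two symbols are torsion under the tame symbol. -/

theorem nsmul_xi_mem_tameKernel {m r : ℕ} (h : D.fX - 1 ∣ (X ^ m - 1) ^ r) :
    (2 * D.N * m * D.N) • D.xi ∈ tameKernel D.kX D.functionFieldX := by
  -- The last factor `N` of the multiple replaces the entry `x` by `x ^ N`, the function `s` of the
  -- local computation.
  rw [mul_nsmul', xi, ← symbol_pow_right]
  have hf0 : D.fX.coeff 0 = 0 := by rw [fX, Polynomial.coeff_X_mul_zero]
  exact nsmul_symbol_mem_tameKernel_of_pow_eq_aeval D.fX_monic hf0 D.N_pos h rfl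
    D.x_mul_prod_y_pow

theorem nsmul_xiE_mem_tameKernel {m r : ℕ} (h : D.fX - 1 ∣ (X ^ m - 1) ^ r) :
    (2 * D.N * m) • D.xiE ∈ tameKernel D.kE D.functionFieldE :=
  nsmul_symbol_mem_tameKernel_of_pow_eq_aeval D.fE_monic D.fE_coeff_zero D.N_pos
    (D.fE_sub_one_dvd h) rfl D.YE_pow

end Datum

end GenFermat

end

theorem theorem3p1 (D : GenFermat.Datum)
    -- `Φ(T) = (T - ν₁) ⋯ (T - νₙ) (T - (-1)ⁿ (ν₁ ⋯ νₙ)⁻¹)` with roots of unity `νᵢ`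
    (ν : Fin D.n → AlgebraicClosure ℚ)
    (hν : ∀ i, ∃ m : ℕ, 0 < m ∧ ν i ^ m = 1)
    (hΦ : D.Phi = (∏ i, (X - C (ν i))) * (X - C ((-1) ^ D.n * (∏ i, ν i)⁻¹))) :
    -- some power of `ξ = {1 - x y₁ ⋯ yₙ, x}` lies in the kernel of the tame symbol on `X_{N,n}`
    (∃ M : ℕ, 0 < M ∧ M • D.xi ∈ GenFermat.tameKernel D.kX D.functionFieldX) ∧
    -- the class of `ξ` lies in `H²_M(X_{N,n}, ℚ(2))`
    (1 : ℚ) ⊗ₜ[ℤ] D.xi ∈ GenFermat.motivicH2 D.kX D.functionFieldX ∧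
    -- the pullback along `X_{N,n} → E_{N,n}`, `(x, y) ↦ (x ^ N, x y₁ ⋯ yₙ)`, takes `{1 - Y, X}` to `N ξ`
    (∃ p : D.functionFieldE →+* D.functionFieldX,
      (∀ c : D.kE, p (algebraMap D.kE D.functionFieldE c)
        = algebraMap D.kX D.functionFieldX (algebraMap D.kE D.kX c)) ∧
      p D.XE = D.x ^ D.N ∧ p D.YE = D.x * ∏ i, D.y i ∧
      GenFermat.MilnorK2.map p D.xiE = D.N • D.xi) ∧
    -- the class of `{1 - Y, X}` lies in `H²_M(E_{N,n}, ℚ(2))`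
    (1 : ℚ) ⊗ₜ[ℤ] D.xiE ∈ GenFermat.motivicH2 D.kE D.functionFieldE := by
  obtain ⟨m, r, hm, hdvd⟩ := D.exists_fX_sub_one_dvd ν hν hΦ
  have hE : 0 < 2 * D.N * m := Nat.mul_pos (Nat.mul_pos two_pos D.N_pos) hm
  have hX : 0 < 2 * D.N * m * D.N := Nat.mul_pos hE D.N_pos
  have h := D.nsmul_xi_mem_tameKernel hdvd
  exact ⟨⟨_, hX, h⟩, GenFermat.one_tmul_mem_motivicH2 hX h,
    ⟨D.pullback, D.pullback_algebraMap_kE, D.pullback_XE, D.pullback_YE, D.map_pullback_xiE⟩,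
    GenFermat.one_tmul_mem_motivicH2 hE (D.nsmul_xiE_mem_tameKernel hdvd)⟩
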